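/- **Language and deductive system.** Formulas are built from countably many variables with the binary connectives $\wedge,\vee,\to,\cdot$, the unary connectives $\neg,\,!$ and the constants $1,0$ (multiplicative) and $\top,\bot$ (additive); $p\mathbin{⅋}q:=\neg p\to q$ and $?p:=\neg\,!\,\neg p$ are abbreviations. ($\cdot,\wedge,\vee$ bind more strongly than $\to$.) $\mathsf{LL}$ is the deductive system whose axioms are all substitution instances of - (HL1) $p\to p$; (HL2) $(p\to q)\to((q\to r)\to(p\to r))$; (HL3) $(p\to(q\to r))\to(q\to(p\to r))$; - (HL4) $\neg\neg p\to p$; (HL5) $(p\to\neg q)\to(q\to\neg p)$; - (HL6) $p\to(q\to p\cdot q)$; (HL7) $(p\to(q\to r))\to(p\cdot q\to r)$; - (HL8) $1$; (HL9) $1\to(p\to p)$; (HL10) $p\to(\neg p\to 0)$; (HL11) $\neg 0$; - (HL12) $p\wedge q\to p$; (HL13) $p\wedge q\to q$; (HL14) $(p\to q)\wedge(p\to r)\to(p\to q\wedge r)$; - (HL15) $p\to p\vee q$; (HL16) $q\to p\vee q$; (HL17) $(p\to r)\wedge(q\to r)\to(p\vee q\to r)$; - (HL18) $p\to\top$; (HL19)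 $\bot\to p$; - (HL20) $q\to(!p\to q)$; (HL21) $(!p\to(!p\to q))\to(!p\to q)$; (HL22) $!(p\to q)\to(!p\to\,!q)$; (HL23) $!p\to p$; (HL24) $!p\to\,!!p$, and whose rules are (MP) $p,\ p\to q\,/\,q$, (Adj) $p,\ q\,/\,p\wedge q$ and (Nec) $p\,/\,!p$. For a set $\Gamma$ of formulas, $\Gamma\vdash_{\mathsf{LL}}p$ means that $p$ is derivable from $\Gamma$ and the axioms by these rules. **Algebras.** A *bounded girale* is an algebra $\langle A,\wedge,\vee,\to,\cdot,\neg,!,1,0,\top,\bot\rangle$ such that $\langle A,\wedge,\vee\rangle$ is a lattice, $\langle A,\cdot,1\rangle$ is a commutative monoid, $ab\le c\iff b\le a\to c$ for all $a,b,c$ (so that we have a commutative residuated lattice), $(a\to 0)\to 0=a$ and $\neg a=a\to 0$ for all $a$ (a Girard algebra), $1\le a\to\top$ for all $a$ and $\bot=\neg\top$ (bounded), and for all $a,b$ $$(\mathrm{G1})\ \ !1=1,\qquad(\mathrm{G2})\ \ !a\le a\wedge 1,\qquad(\mathrm{G3})\ \ !a\cdot{!b}=\,!(a\wedge b),\qquad(\mathrm{G4})\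 \ !!a=\,!a .$$ **Algebraizability (Blok–Pigozzi).** For a class $\mathsf K$ of algebras of this type, $\Theta\vDash_{\mathsf K}\varepsilon\approx\delta$ means that in every member of $\mathsf K$ every assignment that satisfies all equations in $\Theta$ satisfies $\varepsilon\approx\delta$. $\mathsf K$ is an *equivalent algebraic semantics* of a deductive system (a finitary, substitution-invariant consequence relation) $\vdash$ if there are a finite set $E(p)$ of equations in one variable and a finite set $\Delta(p,q)$ of formulas in two variables such that, for all $\Gamma,p,q$, $$\Gamma\vdash p\iff\textstyle\bigcup_{r\in\Gamma}E(r)\vDash_{\mathsf K}E(p),\qquad\text{and}\qquad p\approx q\ \text{ and }\ \textstyle\bigcup_{r\in\Delta(p,q)}E(r)\ \text{ are interderivable in }\vDash_{\mathsf K}.$$ *The* equivalent algebraic semantics is the unique quasivariety (class axiomatized by quasi-equations) that is an equivalent algebraic semantics. The system is *strongly algebraizable* if it has such a quasivariety and this is a variety (a class axiomatized by equations). **Theorem.** $\mathsf{LL}$ is strongly algebraizable. The class $\mathcal G$ of all bounded girales is a variety, and it is the equivalent algebraic semantics of $\mathsf{LL}$: it is an equivalent algebraic semantics of $\mathsf{LL}$,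 and it is the only quasivariety that is one. -/

import Mathlib

universe u

namespace LinearLogic

/-- Formulas of propositional linear logic over countably many variables.  The constants `zero`
and `one` are multiplicative, `top` and `bot` are additive.  "Par" and "why not" are the
abbreviations `p ⅋ q := ¬p → q` and `?p := ¬!¬p`, hence not primitive.
The same type serves as the type of terms of the corresponding algebraic signature. -/
inductive Fm : Type
  | var : ℕ → Fm
  | meet : Fm → Fm → Fm
  | join : Fm → Fm → Fm
  | imp : Fm → Fm → Fm
  | mul : Fm → Fm → Fm
  | neg : Fm → Fm
  | bang : Fm → Fm
  | one : Fm
  | zero : Fm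
  | top : Fm
  | bot : Fm

namespace Fm

/-- Simultaneous substitution of formulas for variables. -/
def subst (σ : ℕ → Fm) : Fm → Fm
  | var n => σ n
  | meet p q => meet (subst σ p) (subst σ q)
  | join p q => join (subst σ p) (subst σ q)
  | imp p q => imp (subst σ p) (subst σ q)
  | mul p q => mul (subst σ p) (subst σ q)
  | neg p => neg (subst σ p)
  | bang p => bang (subst σ p)
  | one => one
  | zero => zero
  | top => top
  | bot => bot

/-- The set of variables that occur in a formula. -/
def vars : Fm → Set ℕ
  | var n => {n}
  | meet p q => vars p ∪ vars q
  | join p q => vars p ∪ vars q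
  | imp p q => vars p ∪ vars q
  | mul p q => vars p ∪ vars q
  | neg p => vars p
  | bang p => vars p
  | one => ∅
  | zero => ∅
  | top => ∅
  | bot => ∅

/-- `t.inst₁ p` is `t(p)`, for a formula `t` in the variable `0`. -/
def inst₁ (t p : Fm) : Fm := t.subst (fun _ => p)

/-- `t.inst₂ p q` is `t(p, q)`, for a formula `t` in the variables `0` and `1`. -/
def inst₂ (t p q : Fm) : Fm := t.subst (fun n => if n = 0 then p else q)

end Fm

infixr:60 " ⊸ " => Fm.imp
infixl:67 " ⋎ " => Fm.join
infixl:68 " ⋏ " => Fm.meet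
infixl:70 " ⊙ " => Fm.mul

/-- The instances of the twenty-four axiom schemes of linear logic. -/
inductive LLAxiom : Fm → Prop
  | hl1 (p : Fm) : LLAxiom (p ⊸ p)
  | hl2 (p q r : Fm) : LLAxiom ((p ⊸ q) ⊸ ((q ⊸ r) ⊸ (p ⊸ r)))
  | hl3 (p q r : Fm) : LLAxiom ((p ⊸ (q ⊸ r)) ⊸ (q ⊸ (p ⊸ r)))
  | hl4 (p : Fm) : LLAxiom (p.neg.neg ⊸ p)
  | hl5 (p q : Fm) : LLAxiom ((p ⊸ q.neg) ⊸ (q ⊸ p.neg))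
  | hl6 (p q : Fm) : LLAxiom (p ⊸ (q ⊸ p ⊙ q))
  | hl7 (p q r : Fm) : LLAxiom ((p ⊸ (q ⊸ r)) ⊸ (p ⊙ q ⊸ r))
  | hl8 : LLAxiom Fm.one
  | hl9 (p : Fm) : LLAxiom (Fm.one ⊸ (p ⊸ p))
  | hl10 (p : Fm) : LLAxiom (p ⊸ (p.neg ⊸ Fm.zero))
  | hl11 : LLAxiom Fm.zero.neg
  | hl12 (p q : Fm) : LLAxiom (p ⋏ q ⊸ p)
  | hl13 (p q : Fm) : LLAxiom (p ⋏ q ⊸ q)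
  | hl14 (p q r : Fm) : LLAxiom ((p ⊸ q) ⋏ (p ⊸ r) ⊸ (p ⊸ q ⋏ r))
  | hl15 (p q : Fm) : LLAxiom (p ⊸ p ⋎ q)
  | hl16 (p q : Fm) : LLAxiom (q ⊸ p ⋎ q)
  | hl17 (p q r : Fm) : LLAxiom ((p ⊸ r) ⋏ (q ⊸ r) ⊸ (p ⋎ q ⊸ r))
  | hl18 (p : Fm) : LLAxiom (p ⊸ Fm.top)
  | hl19 (p : Fm) : LLAxiom (Fm.bot ⊸ p)
  | hl20 (p q : Fm) : LLAxiom (q ⊸ (p.bang ⊸ q))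
  | hl21 (p q : Fm) : LLAxiom ((p.bang ⊸ (p.bang ⊸ q)) ⊸ (p.bang ⊸ q))
  | hl22 (p q : Fm) : LLAxiom ((p ⊸ q).bang ⊸ (p.bang ⊸ q.bang))
  | hl23 (p : Fm) : LLAxiom (p.bang ⊸ p)
  | hl24 (p : Fm) : LLAxiom (p.bang ⊸ p.bang.bang)

/-- `LLDerivable Γ p`: there is a Hilbert-style derivation of `p` from the set of premises `Γ`
by means of the axioms of linear logic and the rules of modus ponens, adjunction and necessitation
(all of which may be applied to formulas that depend on `Γ`). -/
inductive LLDerivable (Γ : Set Fm) : Fm → Prop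
  | hyp {p : Fm} : p ∈ Γ → LLDerivable Γ p
  | ax {p : Fm} : LLAxiom p → LLDerivable Γ p
  | mp {p q : Fm} : LLDerivable Γ p → LLDerivable Γ (p ⊸ q) → LLDerivable Γ q
  | adj {p q : Fm} : LLDerivable Γ p → LLDerivable Γ q → LLDerivable Γ (p ⋏ q)
  | nec {p : Fm} : LLDerivable Γ p → LLDerivable Γ p.bang

/-- A (1-dimensional) deductive system over the language of linear logic: a finitary,
substitution-invariant consequence relation between sets of formulas and formulas. -/
structure DeductiveSystem where
  cons : Set Fm → Fm → Prop
  refl : ∀ {Γ : Set Fm} {p : Fm}, p ∈ Γ → cons Γ p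
  cut : ∀ {Γ Δ : Set Fm} {p : Fm}, (∀ q ∈ Δ, cons Γ q) → cons Δ p → cons Γ p
  structural : ∀ {Γ : Set Fm} {p : Fm} (σ : ℕ → Fm), cons Γ p →
    cons (Fm.subst σ '' Γ) (p.subst σ)
  finitary : ∀ {Γ : Set Fm} {p : Fm}, cons Γ p → ∃ Γ' : Set Fm, Γ' ⊆ Γ ∧ Γ'.Finite ∧ cons Γ' p

theorem LLAxiom.subst {p : Fm} (σ : ℕ → Fm) (h : LLAxiom p) : LLAxiom (p.subst σ) := by
  cases h <;> constructor

theorem LLDerivable.cut {Γ Δ : Set Fm} {p : Fm} (h : ∀ q ∈ Δ, LLDerivable Γ q)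
    (hp : LLDerivable Δ p) : LLDerivable Γ p := by
  induction hp with
  | hyp hq => exact h _ hq
  | mp _ _ ih₁ ih₂ => exact .mp ih₁ ih₂
  | adj _ _ ih₁ ih₂ => exact .adj ih₁ ih₂
  | nec _ ih => exact .nec ih
  | ax h => exact .ax h

theorem LLDerivable.structural {Γ : Set Fm} {p : Fm} (σ : ℕ → Fm) (hp : LLDerivable Γ p) :
    LLDerivable (Fm.subst σ '' Γ) (p.subst σ) := by
  induction hp with
  | hyp hq => exact .hyp ⟨_, hq, rfl⟩
  | mp _ _ ih₁ ih₂ => exact .mp ih₁ ih₂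
  | adj _ _ ih₁ ih₂ => exact .adj ih₁ ih₂
  | nec _ ih => exact .nec ih
  | ax h => exact .ax (h.subst σ)

theorem LLDerivable.finitary {Γ : Set Fm} {p : Fm} (hp : LLDerivable Γ p) :
    ∃ Γ' : Set Fm, Γ' ⊆ Γ ∧ Γ'.Finite ∧ LLDerivable Γ' p := by
  induction hp with
  | @hyp q hq =>
    exact ⟨{q}, Set.singleton_subset_iff.2 hq, Set.finite_singleton q, .hyp rfl⟩
  | mp _ _ ih₁ ih₂ =>
    obtain ⟨A, hA, fA, dA⟩ := ih₁
    obtain ⟨B, hB, fB, dB⟩ := ih₂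
    exact ⟨A ∪ B, Set.union_subset hA hB, fA.union fB,
      .mp (dA.cut fun _ h => .hyp (Or.inl h)) (dB.cut fun _ h => .hyp (Or.inr h))⟩
  | adj _ _ ih₁ ih₂ =>
    obtain ⟨A, hA, fA, dA⟩ := ih₁
    obtain ⟨B, hB, fB, dB⟩ := ih₂
    exact ⟨A ∪ B, Set.union_subset hA hB, fA.union fB,
      .adj (dA.cut fun _ h => .hyp (Or.inl h)) (dB.cut fun _ h => .hyp (Or.inr h))⟩
  | nec _ ih =>
    obtain ⟨A, hA, fA, dA⟩ := ih
    exact ⟨A, hA, fA, .nec dA⟩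
  | ax h => exact ⟨∅, Set.empty_subset _, Set.finite_empty, .ax h⟩

/-- Linear logic as a deductive system. -/
def LL : DeductiveSystem where
  cons := LLDerivable
  refl := .hyp
  cut := LLDerivable.cut
  structural := LLDerivable.structural
  finitary := LLDerivable.finitary

/-- Algebras whose type is the language of linear logic (no laws are imposed here). -/
structure LLAlgebra where
  carrier : Type u
  meet : carrier → carrier → carrier
  join : carrier → carrier → carrier
  imp : carrier → carrier → carrier
  mul : carrier → carrier → carrier
  neg : carrier → carrier
  bang : carrier → carrier
  one : carrier
  zero : carrier
  top : carrier
  bot : carrier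

namespace LLAlgebra

/-- The value of a term under an assignment of elements to the variables. -/
def eval (A : LLAlgebra.{u}) (v : ℕ → A.carrier) : Fm → A.carrier
  | .var n => v n
  | .meet p q => A.meet (A.eval v p) (A.eval v q)
  | .join p q => A.join (A.eval v p) (A.eval v q)
  | .imp p q => A.imp (A.eval v p) (A.eval v q)
  | .mul p q => A.mul (A.eval v p) (A.eval v q)
  | .neg p => A.neg (A.eval v p)
  | .bang p => A.bang (A.eval v p)
  | .one => A.one
  | .zero => A.zero
  | .top => A.top
  | .bot => A.bot

/-- The lattice order: `a ≤ b` means `a ∧ b = a`. -/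
def le (A : LLAlgebra.{u}) (a b : A.carrier) : Prop := A.meet a b = a

/-- The reduct `(A, ∨, ∧, →, ·, 1)` is a commutative residuated lattice. -/
structure IsCommResiduatedLattice (A : LLAlgebra.{u}) : Prop where
  meet_comm : ∀ a b, A.meet a b = A.meet b a
  meet_assoc : ∀ a b c, A.meet (A.meet a b) c = A.meet a (A.meet b c)
  join_comm : ∀ a b, A.join a b = A.join b a
  join_assoc : ∀ a b c, A.join (A.join a b) c = A.join a (A.join b c)
  meet_join_self : ∀ a b, A.meet a (A.join a b) = a
  join_meet_self : ∀ a b, A.join a (A.meet a b) = a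
  mul_comm : ∀ a b, A.mul a b = A.mul b a
  mul_assoc : ∀ a b c, A.mul (A.mul a b) c = A.mul a (A.mul b c)
  one_mul : ∀ a, A.mul A.one a = a
  residuation : ∀ a b c, A.le (A.mul a b) c ↔ A.le b (A.imp a c)

/-- The reduct `(A, ∨, ∧, →, ·, 0, 1)`, with `¬a = a → 0`, is a Girard algebra. -/
structure IsGirardAlgebra (A : LLAlgebra.{u}) : Prop extends IsCommResiduatedLattice A where
  zero_involutive : ∀ a, A.imp (A.imp a A.zero) A.zero = a
  neg_eq : ∀ a, A.neg a = A.imp a A.zero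

/-- The reduct without the exponential is a bounded Girard algebra, with `⊥ = ¬⊤`. -/
structure IsBoundedGirardAlgebra (A : LLAlgebra.{u}) : Prop extends IsGirardAlgebra A where
  one_le_imp_top : ∀ a, A.le A.one (A.imp a A.top)
  bot_eq : A.bot = A.neg A.top

/-- `A` is a bounded girale. -/
structure IsBoundedGirale (A : LLAlgebra.{u}) : Prop extends IsBoundedGirardAlgebra A where
  bang_one : A.bang A.one = A.one
  bang_le : ∀ a, A.le (A.bang a) (A.meet a A.one)
  bang_mul_bang : ∀ a b, A.mul (A.bang a) (A.bang b) = A.bang (A.meet a b)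
  bang_bang : ∀ a, A.bang (A.bang a) = A.bang a

end LLAlgebra

/-- The class of bounded girales. -/
def boundedGirales : Set LLAlgebra.{u} := {A | A.IsBoundedGirale}

/-- An equation `t₁ ≈ t₂`. -/
abbrev Equation : Type := Fm × Fm

/-- The equation `e` holds in `A` under the assignment `v`. -/
def Equation.HoldsAt (e : Equation) (A : LLAlgebra.{u}) (v : ℕ → A.carrier) : Prop :=
  A.eval v e.1 = A.eval v e.2

/-- `Θ ⊨_K e`, the equational consequence relation of a class `K` of algebras. -/
def EqConsequence (K : Set LLAlgebra.{u}) (Θ : Set Equation) (e : Equation) : Prop :=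
  ∀ A ∈ K, ∀ v : ℕ → A.carrier, (∀ t ∈ Θ, t.HoldsAt A v) → e.HoldsAt A v

/-- A variety: a class of algebras axiomatized by a set of equations. -/
def IsVariety (K : Set LLAlgebra.{u}) : Prop :=
  ∃ Ax : Set Equation, ∀ A : LLAlgebra.{u},
    A ∈ K ↔ ∀ e ∈ Ax, ∀ v : ℕ → A.carrier, e.HoldsAt A v

/-- A quasivariety: a class of algebras axiomatized by a set of quasi-equations, that is,
implications from a finite set of equations to an equation. -/
def IsQuasivariety (K : Set LLAlgebra.{u}) : Prop :=
  ∃ Ax : Set (Finset Equation × Equation), ∀ A : LLAlgebra.{u},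
    A ∈ K ↔ ∀ e ∈ Ax, ∀ v : ℕ → A.carrier, (∀ t ∈ e.1, t.HoldsAt A v) → e.2.HoldsAt A v

/-- `E(p)`: the instances at the formula `p` of a set `E` of equations in one variable. -/
def eqInst (E : Finset Equation) (p : Fm) : Set Equation :=
  {e | ∃ d ∈ E, e = (d.1.inst₁ p, d.2.inst₁ p)}

/-- `D(p, q)`: the instances at `p, q` of a set `D` of formulas in two variables. -/
def fmInst (D : Finset Fm) (p q : Fm) : Set Fm :=
  {r | ∃ d ∈ D, r = d.inst₂ p q}

/-- `K` is an algebraic semantics of `S` with defining equations `E`: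
`Γ ⊢_S p` if and only if `{E(q) : q ∈ Γ} ⊨_K E(p)`. -/
def IsAlgebraicSemantics (S : DeductiveSystem) (K : Set LLAlgebra.{u}) (E : Finset Equation) :
    Prop :=
  (∀ d ∈ E, d.1.vars ⊆ {0} ∧ d.2.vars ⊆ {0}) ∧
  ∀ (Γ : Set Fm) (p : Fm),
    S.cons Γ p ↔ ∀ e ∈ eqInst E p, EqConsequence K (⋃ q ∈ Γ, eqInst E q) e

/-- `K` is an equivalent algebraic semantics of `S` in the sense of Blok and Pigozzi: it is an
algebraic semantics with a finite set `E` of defining equations, and there is a finite set `D` of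
equivalence formulas such that `p ≈ q` and `E(D(p, q))` are interderivable in `⊨_K`. -/
def IsEquivalentAlgebraicSemantics (S : DeductiveSystem) (K : Set LLAlgebra.{u}) : Prop :=
  ∃ (E : Finset Equation) (D : Finset Fm),
    IsAlgebraicSemantics S K E ∧
    (∀ d ∈ D, d.vars ⊆ {0, 1}) ∧
    ∀ p q : Fm,
      (∀ r ∈ fmInst D p q, ∀ e ∈ eqInst E r, EqConsequence K {(p, q)} e) ∧
      EqConsequence K (⋃ r ∈ fmInst D p q, eqInst E r) (p, q)

/-- `K` is *the* equivalent algebraic semantics of `S`: the unique quasivariety that is an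
equivalent algebraic semantics of `S`. -/
def IsTheEquivalentAlgebraicSemantics (S : DeductiveSystem) (K : Set LLAlgebra.{u}) : Prop :=
  (IsQuasivariety K ∧ IsEquivalentAlgebraicSemantics S K) ∧
  ∀ K' : Set LLAlgebra.{u},
    IsQuasivariety K' → IsEquivalentAlgebraicSemantics S K' → K' = K

/-- `S` is strongly algebraizable: it is algebraizable, and its equivalent algebraic semantics
is a variety. -/
def IsStronglyAlgebraizable (S : DeductiveSystem) : Prop :=
  ∃ K : Set LLAlgebra.{u}, IsTheEquivalentAlgebraicSemantics S K ∧ IsVariety K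

end LinearLogic

/-!
Validity of a formula in a bounded girale means `1 ≤ p`, and `p → q` is valid exactly when `p ≤ q`.
Hence the defining equation `1 ∧ x ≈ 1` and the equivalence formulas `x → y`, `y → x` turn
deducibility into the equational logic of bounded girales: soundness is a computation in residuated
lattices, and completeness holds because the formulas modulo provable equivalence from `Γ` form a
bounded girale in which exactly the consequences of `Γ` lie above `1`.

Two algebraizations of one deductive system have interderivable equivalence formulas, since each
set of them defines a congruence for the other. So both classes have the same equational
consequence relation, which determines a quasivariety.

Finally, residuation is equivalent to identities because `a · (-)` preserves joins, which makes
bounded girales a variety.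
-/

namespace LinearLogic

/-! ### Algebraizations and their uniqueness -/

section Algebraization

variable {S : DeductiveSystem} {K K' : Set LLAlgebra.{u}} {E E' : Finset Equation}
  {D D' : Finset Fm} {A : LLAlgebra.{u}} {v : ℕ → A.carrier} {p q r : Fm}

theorem LLAlgebra.eval_subst (A : LLAlgebra.{u}) (v : ℕ → A.carrier) (σ : ℕ → Fm) (t : Fm) :
    A.eval v (t.subst σ) = A.eval (fun n => A.eval v (σ n)) t := by
  induction t <;> simp_all only [Fm.subst, LLAlgebra.eval]

theorem LLAlgebra.eval_inst₂_congr {p' q' : Fm} (hp : A.eval v p = A.eval v p')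
    (hq : A.eval v q = A.eval v q') (t : Fm) :
    A.eval v (t.inst₂ p q) = A.eval v (t.inst₂ p' q') := by
  simp only [Fm.inst₂, LLAlgebra.eval_subst, apply_ite (A.eval v), hp, hq]

/-- The set of solutions in `A` of a finite set `E` of equations in one variable. When `E` is the
set of defining equations of an algebraic semantics, these are the truth values of `A` that count
as true. -/
def LLAlgebra.designated (A : LLAlgebra.{u}) (E : Finset Equation) : Set A.carrier :=
  {a | ∀ d ∈ E, d.HoldsAt A fun _ => a}

theorem forall_mem_eqInst_holdsAt_iff :
    (∀ e ∈ eqInst E p, e.HoldsAt A v) ↔ A.eval v p ∈ A.designated E := by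
  simp only [eqInst, LLAlgebra.designated, Set.mem_ofPred_eq, forall_exists_index, and_imp,
    Equation.HoldsAt, ← LLAlgebra.eval_subst]
  exact ⟨fun h d hd => h _ d hd rfl, fun h e d hd he => he ▸ h d hd⟩

theorem forall_mem_biUnion_eqInst_holdsAt_iff {Γ : Set Fm} :
    (∀ e ∈ ⋃ q ∈ Γ, eqInst E q, e.HoldsAt A v) ↔ ∀ q ∈ Γ, A.eval v q ∈ A.designated E := by
  simp only [Set.mem_iUnion₂, ← forall_mem_eqInst_holdsAt_iff]
  exact ⟨fun h q hq e he => h e ⟨q, hq, he⟩, fun h e ⟨q, hq, he⟩ => h q hq e he⟩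

/-- The two conditions of Blok and Pigozzi read pointwise in the algebras of `K`: `S` is
preservation of designated values, and `D` defines equality of values. -/
structure IsAlgebraization (S : DeductiveSystem) (K : Set LLAlgebra.{u}) (E : Finset Equation)
    (D : Finset Fm) : Prop where
  cons_iff (Γ : Set Fm) (p : Fm) : S.cons Γ p ↔ ∀ A ∈ K, ∀ v : ℕ → A.carrier,
    (∀ q ∈ Γ, A.eval v q ∈ A.designated E) → A.eval v p ∈ A.designated E
  eval_eq_iff (A : LLAlgebra.{u}) (hA : A ∈ K) (v : ℕ → A.carrier) (p q : Fm) :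
    A.eval v p = A.eval v q ↔ ∀ r ∈ fmInst D p q, A.eval v r ∈ A.designated E

theorem isAlgebraicSemantics_iff :
    IsAlgebraicSemantics S K E ↔ (∀ d ∈ E, d.1.vars ⊆ {0} ∧ d.2.vars ⊆ {0}) ∧
      ∀ Γ p, S.cons Γ p ↔ ∀ A ∈ K, ∀ v : ℕ → A.carrier,
        (∀ q ∈ Γ, A.eval v q ∈ A.designated E) → A.eval v p ∈ A.designated E := by
  refine and_congr_right fun _ => forall₂_congr fun Γ p => iff_congr Iff.rfl ?_
  simp only [EqConsequence, forall_mem_biUnion_eqInst_holdsAt_iff, ← forall_mem_eqInst_holdsAt_iff]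
  exact ⟨fun h A hA v hv e he => h e he A hA v hv, fun h e he A hA v hv => h A hA v hv e he⟩

theorem interderivable_iff_eval_eq_iff :
    ((∀ r ∈ fmInst D p q, ∀ e ∈ eqInst E r, EqConsequence K {(p, q)} e) ∧
      EqConsequence K (⋃ r ∈ fmInst D p q, eqInst E r) (p, q)) ↔
    ∀ A ∈ K, ∀ v : ℕ → A.carrier,
      A.eval v p = A.eval v q ↔ ∀ r ∈ fmInst D p q, A.eval v r ∈ A.designated E := by
  simp only [EqConsequence, forall_mem_biUnion_eqInst_holdsAt_iff, ← forall_mem_eqInst_holdsAt_iff,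
    Set.mem_singleton_iff, forall_eq]
  exact ⟨fun ⟨h₁, h₂⟩ A hA v => ⟨fun h r hr e he => h₁ r hr e he A hA v h, h₂ A hA v⟩,
    fun h => ⟨fun r hr e he A hA v hv => (h A hA v).1 hv r hr e he, fun A hA v => (h A hA v).2⟩⟩

theorem isEquivalentAlgebraicSemantics_iff :
    IsEquivalentAlgebraicSemantics S K ↔ ∃ (E : Finset Equation) (D : Finset Fm),
      (∀ d ∈ E, d.1.vars ⊆ {0} ∧ d.2.vars ⊆ {0}) ∧ (∀ d ∈ D, d.vars ⊆ {0, 1}) ∧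
      IsAlgebraization S K E D := by
  refine exists₂_congr fun E D => ?_
  simp only [isAlgebraicSemantics_iff, interderivable_iff_eval_eq_iff]
  exact ⟨fun ⟨⟨hE, h₁⟩, hD, h₂⟩ => ⟨hE, hD, h₁, fun A hA v p q => h₂ p q A hA v⟩,
    fun ⟨hE, hD, h⟩ => ⟨⟨hE, h.cons_iff⟩, hD, fun p q A hA v => h.eval_eq_iff A hA v p q⟩⟩

namespace IsAlgebraization

theorem cons_of_mem_fmInst_self (h : IsAlgebraization S K E D) (hr : r ∈ fmInst D p p) :
    S.cons ∅ r :=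
  (h.cons_iff _ _).2 fun A hA v _ => (h.eval_eq_iff A hA v p p).1 rfl r hr

theorem cons_fmInst_inst₂ (h : IsAlgebraization S K E D) {t : Fm}
    (ht : S.cons ∅ (t.inst₂ p p)) : S.cons (fmInst D p q) (t.inst₂ p q) := by
  refine (h.cons_iff _ _).2 fun A hA v hD => ?_
  have hpq : A.eval v p = A.eval v q := (h.eval_eq_iff A hA v p q).2 hD
  rw [← LLAlgebra.eval_inst₂_congr rfl hpq]
  exact (h.cons_iff _ _).1 ht A hA v fun _ hq => absurd hq (Set.notMem_empty _)

theorem cons_fmInst_of_mem_fmInst (h : IsAlgebraization S K E D)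
    (h' : IsAlgebraization S K' E' D') (hr : r ∈ fmInst D' p q) : S.cons (fmInst D p q) r := by
  obtain ⟨d, hd, rfl⟩ := hr
  exact h.cons_fmInst_inst₂ (h'.cons_of_mem_fmInst_self ⟨d, hd, rfl⟩)

theorem eqConsequence_iff (h : IsAlgebraization S K E D) (Θ : Set Equation) (e : Equation) :
    EqConsequence K Θ e ↔ ∀ r ∈ fmInst D e.1 e.2, S.cons (⋃ t ∈ Θ, fmInst D t.1 t.2) r := by
  have holdsAt_iff {A} (hA : A ∈ K) (v) : (∀ t ∈ Θ, t.HoldsAt A v) ↔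
      ∀ r ∈ ⋃ t ∈ Θ, fmInst D t.1 t.2, A.eval v r ∈ A.designated E := by
    simp only [Equation.HoldsAt, h.eval_eq_iff A hA, Set.mem_iUnion₂]
    exact ⟨fun hv r ⟨t, ht, hr⟩ => hv t ht r hr, fun hv t ht r hr => hv r ⟨t, ht, hr⟩⟩
  simp only [h.cons_iff]
  constructor
  · intro he r hr A hA v hv
    exact (h.eval_eq_iff A hA v _ _).1 (he A hA v ((holdsAt_iff hA v).2 hv)) r hr
  · intro he A hA v hv
    exact (h.eval_eq_iff A hA v _ _).2 fun r hr => he r hr A hA v ((holdsAt_iff hA v).1 hv)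

theorem eqConsequence_of_eqConsequence (h : IsAlgebraization S K E D)
    (h' : IsAlgebraization S K' E' D') {Θ : Set Equation} {e : Equation}
    (he : EqConsequence K Θ e) : EqConsequence K' Θ e := by
  rw [h.eqConsequence_iff] at he
  rw [h'.eqConsequence_iff]
  have premises : ∀ r ∈ ⋃ t ∈ Θ, fmInst D t.1 t.2, S.cons (⋃ t ∈ Θ, fmInst D' t.1 t.2) r := by
    simp only [Set.mem_iUnion₂, forall_exists_index]
    intro r t ht hr
    exact S.cut (fun s hs => S.refl (Set.mem_biUnion ht hs)) (h'.cons_fmInst_of_mem_fmInst h hr)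
  exact fun r hr => S.cut (fun s hs => S.cut premises (he s hs)) (h.cons_fmInst_of_mem_fmInst h' hr)

end IsAlgebraization

theorem IsQuasivariety.subset_of_eqConsequence (hK : IsQuasivariety K)
    (h : ∀ Θ e, EqConsequence K Θ e → EqConsequence K' Θ e) : K' ⊆ K := by
  obtain ⟨Ax, hAx⟩ := hK
  refine fun A hA => (hAx A).2 fun e he => h {t | t ∈ e.1} e.2 (fun B hB => ?_) A hA
  exact (hAx B).1 hB e he

theorem IsEquivalentAlgebraicSemantics.unique (h : IsEquivalentAlgebraicSemantics S K)
    (h' : IsEquivalentAlgebraicSemantics S K') (hK : IsQuasivariety K)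
    (hK' : IsQuasivariety K') : K = K' := by
  obtain ⟨E, D, -, -, h⟩ := isEquivalentAlgebraicSemantics_iff.1 h
  obtain ⟨E', D', -, -, h'⟩ := isEquivalentAlgebraicSemantics_iff.1 h'
  exact (hK'.subset_of_eqConsequence fun _ _ => h'.eqConsequence_of_eqConsequence h).antisymm
    (hK.subset_of_eqConsequence fun _ _ => h.eqConsequence_of_eqConsequence h')

theorem IsVariety.isQuasivariety (hK : IsVariety K) : IsQuasivariety K := by
  obtain ⟨Ax, hAx⟩ := hK
  refine ⟨(fun e => (∅, e)) '' Ax, fun A => (hAx A).trans ?_⟩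
  simp only [Set.forall_mem_image, Finset.notMem_empty, IsEmpty.forall_iff, implies_true,
    forall_const]

end Algebraization

/-! ### Residuated lattices and exponentials -/

/-- A commutative residuated lattice, with the residual of multiplication written `⇨`. -/
class CommResiduatedLattice (α : Type*) extends Lattice α, CommMonoid α, HImp α where
  mul_le_iff_le_himp (a b c : α) : a * b ≤ c ↔ b ≤ a ⇨ c

namespace CommResiduatedLattice

variable {α : Type*} [CommResiduatedLattice α] {a b : α}

theorem gc_mul_himp (a : α) : GaloisConnection (a * ·) (a ⇨ ·) :=
  mul_le_iff_le_himp a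

instance : IsOrderedMonoid α where
  mul_le_mul_left a b hab c := by
    rw [mul_comm a, mul_comm b]
    exact (gc_mul_himp c).monotone_l hab

theorem one_le_himp_iff : 1 ≤ a ⇨ b ↔ a ≤ b := by
  rw [← mul_le_iff_le_himp, mul_one]

theorem mul_himp_le (a b : α) : a * (a ⇨ b) ≤ b :=
  (gc_mul_himp a).l_u_le b

theorem le_himp_mul (a b : α) : a ≤ b ⇨ a * b := by
  rw [← mul_le_iff_le_himp, mul_comm]

theorem mul_himp (a b c : α) : a * b ⇨ c = a ⇨ b ⇨ c :=
  eq_of_forall_le_iff fun x => by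
    rw [← mul_le_iff_le_himp, ← mul_le_iff_le_himp, ← mul_le_iff_le_himp, mul_left_comm, mul_assoc]

protected theorem himp_left_comm (a b c : α) : a ⇨ b ⇨ c = b ⇨ a ⇨ c := by
  rw [← mul_himp, mul_comm, mul_himp]

theorem himp_inf (a b c : α) : a ⇨ b ⊓ c = (a ⇨ b) ⊓ (a ⇨ c) :=
  (gc_mul_himp a).u_inf

theorem sup_himp (a b c : α) : a ⊔ b ⇨ c = (a ⇨ c) ⊓ (b ⇨ c) :=
  eq_of_forall_le_iff fun x => by
    rw [← mul_le_iff_le_himp, mul_comm, mul_le_iff_le_himp, sup_le_iff, le_inf_iff,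
      ← mul_le_iff_le_himp, ← mul_le_iff_le_himp, ← mul_le_iff_le_himp, ← mul_le_iff_le_himp,
      mul_comm x, mul_comm x]

theorem mul_sup (a b c : α) : a * (b ⊔ c) = a * b ⊔ a * c :=
  (gc_mul_himp a).l_sup

theorem himp_le_himp_himp (a b c : α) : a ⇨ b ≤ (b ⇨ c) ⇨ a ⇨ c := by
  rw [← mul_le_iff_le_himp, ← mul_le_iff_le_himp]
  calc a * ((b ⇨ c) * (a ⇨ b)) = (b ⇨ c) * (a * (a ⇨ b)) := mul_left_comm _ _ _
    _ ≤ (b ⇨ c) * b := mul_le_mul_right (mul_himp_le a b) _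
    _ = b * (b ⇨ c) := mul_comm _ _
    _ ≤ c := mul_himp_le b c

protected theorem himp_le_himp_right (hab : a ≤ b) (c : α) : b ⇨ c ≤ a ⇨ c :=
  one_le_himp_iff.1 ((one_le_himp_iff.2 hab).trans (himp_le_himp_himp a b c))

end CommResiduatedLattice

/-- The axioms (G1)-(G4) of the exponential `!` of a girale. -/
structure IsExponential {α : Type*} [SemilatticeInf α] [Monoid α] (bang : α → α) : Prop where
  map_one : bang 1 = 1
  le_inf_one (a : α) : bang a ≤ a ⊓ 1
  mul_eq_map_inf (a b : α) : bang a * bang b = bang (a ⊓ b)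
  map_map (a : α) : bang (bang a) = bang a

namespace IsExponential

section Monoid

variable {α : Type*} [SemilatticeInf α] [Monoid α] {bang : α → α} {a b : α}

theorem le_self (h : IsExponential bang) (a : α) : bang a ≤ a :=
  (h.le_inf_one a).trans inf_le_left

theorem le_one (h : IsExponential bang) (a : α) : bang a ≤ 1 :=
  (h.le_inf_one a).trans inf_le_right

theorem mul_self (h : IsExponential bang) (a : α) : bang a * bang a = bang a := by
  rw [h.mul_eq_map_inf, inf_idem]

theorem monotone [MulRightMono α] (h : IsExponential bang) : Monotone bang := fun a b hab =>
  calc bang a = bang a * bang b := by rw [h.mul_eq_map_inf, inf_eq_left.2 hab]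
    _ ≤ bang b := mul_le_of_le_one_left' (h.le_one a)

end Monoid

section CommResiduatedLattice

variable {α : Type*} [CommResiduatedLattice α] {bang : α → α}

theorem himp_himp (h : IsExponential bang) (a b : α) : bang a ⇨ bang a ⇨ b = bang a ⇨ b := by
  rw [← CommResiduatedLattice.mul_himp, h.mul_self]

theorem map_himp_le (h : IsExponential bang) (a b : α) : bang (a ⇨ b) ≤ bang a ⇨ bang b := by
  rw [← CommResiduatedLattice.mul_le_iff_le_himp]
  calc bang a * bang (a ⇨ b) = bang (bang a * bang (a ⇨ b)) := by
        rw [h.mul_eq_map_inf, h.map_map]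
    _ ≤ bang (a * (a ⇨ b)) := h.monotone (mul_le_mul' (h.le_self a) (h.le_self _))
    _ ≤ bang b := h.monotone (CommResiduatedLattice.mul_himp_le a b)

end CommResiduatedLattice

end IsExponential

/-! ### Soundness -/

namespace LLAlgebra

variable {A : LLAlgebra.{u}}

/-- The lattice given by the operations `meet` and `join` of an algebra that satisfies the lattice
identities. The order is `A.le` by definition. -/
abbrev toLattice (A : LLAlgebra.{u})
    (meet_comm : ∀ a b, A.meet a b = A.meet b a)
    (meet_assoc : ∀ a b c, A.meet (A.meet a b) c = A.meet a (A.meet b c))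
    (join_comm : ∀ a b, A.join a b = A.join b a)
    (join_assoc : ∀ a b c, A.join (A.join a b) c = A.join a (A.join b c))
    (meet_join_self : ∀ a b, A.meet a (A.join a b) = a)
    (join_meet_self : ∀ a b, A.join a (A.meet a b) = a) : Lattice A.carrier :=
  letI : Max A.carrier := ⟨A.join⟩
  letI : Min A.carrier := ⟨A.meet⟩
  letI lattice : Lattice A.carrier := .mk' join_comm join_assoc meet_comm meet_assoc
    join_meet_self meet_join_self
  lattice.copy A.le (funext₂ fun _ _ => propext inf_eq_left) A.join rfl A.meet rfl

/-- The residuated lattice carried by an algebra that satisfies the laws. The order is `A.le` by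
definition. -/
abbrev IsCommResiduatedLattice.toCommResiduatedLattice (h : A.IsCommResiduatedLattice) :
    CommResiduatedLattice A.carrier :=
  { A.toLattice h.meet_comm h.meet_assoc h.join_comm h.join_assoc h.meet_join_self
      h.join_meet_self with
    mul := A.mul
    one := A.one
    himp := A.imp
    mul_comm := h.mul_comm
    mul_assoc := h.mul_assoc
    one_mul := h.one_mul
    mul_one := fun a => (h.mul_comm a A.one).trans (h.one_mul a)
    mul_le_iff_le_himp := h.residuation }

theorem IsCommResiduatedLattice.one_le_imp_iff (h : A.IsCommResiduatedLattice) {a b : A.carrier} :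
    A.le A.one (A.imp a b) ↔ A.le a b :=
  let := h.toCommResiduatedLattice
  CommResiduatedLattice.one_le_himp_iff (a := a) (b := b)

namespace IsBoundedGirale

theorem isExponential (h : A.IsBoundedGirale) :
    letI := h.toCommResiduatedLattice
    IsExponential A.bang :=
  letI := h.toCommResiduatedLattice
  { map_one := h.bang_one
    le_inf_one := h.bang_le
    mul_eq_map_inf := h.bang_mul_bang
    map_map := h.bang_bang }

theorem le_top (h : A.IsBoundedGirale) (a : A.carrier) : A.le a A.top :=
  h.one_le_imp_iff.1 (h.one_le_imp_top a)

theorem bot_le (h : A.IsBoundedGirale) (a : A.carrier) : A.le A.bot a := by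
  let := h.toCommResiduatedLattice
  have : A.imp A.top A.zero ≤ A.imp (A.imp a A.zero) A.zero :=
    CommResiduatedLattice.himp_le_himp_right (h.le_top _) A.zero
  rwa [h.zero_involutive, ← h.neg_eq, ← h.bot_eq] at this

open CommResiduatedLattice in
theorem one_le_eval_of_llAxiom (h : A.IsBoundedGirale) (v : ℕ → A.carrier) {p : Fm}
    (hp : LLAxiom p) : A.le A.one (A.eval v p) := by
  let := h.toCommResiduatedLattice
  have one_le_imp {p q : Fm} (hpq : A.eval v p ≤ A.eval v q) : A.le A.one (A.eval v (p ⊸ q)) :=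
    h.one_le_imp_iff.2 hpq
  cases hp with
  | hl1 p => exact one_le_imp le_rfl
  | hl2 p q r => exact one_le_imp (himp_le_himp_himp _ _ _)
  | hl3 p q r => exact one_le_imp (CommResiduatedLattice.himp_left_comm _ _ _).le
  | hl4 p => exact one_le_imp (by simp only [eval, h.neg_eq, h.zero_involutive, le_rfl])
  | hl5 p q =>
    refine one_le_imp ?_
    simp only [eval, h.neg_eq]
    exact (CommResiduatedLattice.himp_left_comm _ _ _).le
  | hl6 p q => exact one_le_imp (le_himp_mul _ _)
  | hl7 p q r => exact one_le_imp (mul_himp _ _ _).ge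
  | hl8 => exact le_refl A.one
  | hl9 p => exact one_le_imp (one_le_imp le_rfl)
  | hl10 p =>
    refine one_le_imp ?_
    simp only [eval, h.neg_eq]
    exact (mul_le_iff_le_himp _ _ _).1 ((mul_comm _ _).trans_le (mul_himp_le _ _))
  | hl11 =>
    simp only [eval, h.neg_eq]
    exact h.one_le_imp_iff.2 (le_refl A.zero)
  | hl12 p q => exact one_le_imp inf_le_left
  | hl13 p q => exact one_le_imp inf_le_right
  | hl14 p q r => exact one_le_imp (himp_inf _ _ _).ge
  | hl15 p q => exact one_le_imp le_sup_left
  | hl16 p q => exact one_le_imp le_sup_right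
  | hl17 p q r => exact one_le_imp (sup_himp _ _ _).ge
  | hl18 p => exact one_le_imp (h.le_top _)
  | hl19 p => exact one_le_imp (h.bot_le _)
  | hl20 p q =>
    exact one_le_imp <| (mul_le_iff_le_himp _ _ _).1 <|
      mul_le_of_le_one_left' (h.isExponential.le_one _)
  | hl21 p q => exact one_le_imp (h.isExponential.himp_himp _ _).le
  | hl22 p q => exact one_le_imp (h.isExponential.map_himp_le _ _)
  | hl23 p => exact one_le_imp (h.isExponential.le_self _)
  | hl24 p => exact one_le_imp (h.bang_bang _).ge

theorem one_le_eval_of_llDerivable (h : A.IsBoundedGirale) (v : ℕ → A.carrier) {Γ : Set Fm}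
    (hΓ : ∀ q ∈ Γ, A.le A.one (A.eval v q)) {p : Fm} (hp : LLDerivable Γ p) :
    A.le A.one (A.eval v p) := by
  let := h.toCommResiduatedLattice
  induction hp with
  | hyp hq => exact hΓ _ hq
  | ax hp => exact h.one_le_eval_of_llAxiom v hp
  | @mp p q _ _ hp hpq =>
    have hpq : A.eval v p ≤ A.eval v q := h.one_le_imp_iff.1 hpq
    exact le_trans hp hpq
  | @adj p q _ _ hp hq =>
    have hpq : A.one ≤ A.eval v p ⊓ A.eval v q := le_inf hp hq
    exact hpq
  | nec _ hp => exact h.bang_one ▸ h.isExponential.monotone hp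

end IsBoundedGirale

end LLAlgebra

/-! ### Bounded girales form a variety -/

theorem galoisConnection_of_map_sup {α β : Type*} [SemilatticeSup α] [SemilatticeSup β]
    {l : α → β} {u : β → α} (map_sup : ∀ a b, l (a ⊔ b) = l a ⊔ l b) (l_u_le : ∀ b, l (u b) ≤ b)
    (le_u_sup : ∀ a b, a ≤ u (l a ⊔ b)) : GaloisConnection l u := by
  have l_mono : Monotone l := fun a b hab => by
    rw [← sup_eq_right.2 hab, map_sup]
    exact le_sup_left
  intro a b
  constructor
  · intro h
    simpa only [sup_eq_right.2 h] using le_u_sup a b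
  · intro h
    exact (l_mono h).trans (l_u_le b)

/-- An equational axiomatization of bounded girales. Residuation is replaced by `mul_join`,
`mul_imp_le` and `le_imp_mul_join`, where an inequality `s ≤ t` is written as the equation
`s ∧ t ≈ s`. -/
inductive BoundedGiraleIdentity : Equation → Prop
  | meet_comm (p q : Fm) : BoundedGiraleIdentity (p ⋏ q, q ⋏ p)
  | meet_assoc (p q r : Fm) : BoundedGiraleIdentity (p ⋏ q ⋏ r, p ⋏ (q ⋏ r))
  | join_comm (p q : Fm) : BoundedGiraleIdentity (p ⋎ q, q ⋎ p)
  | join_assoc (p q r : Fm) : BoundedGiraleIdentity (p ⋎ q ⋎ r, p ⋎ (q ⋎ r))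
  | meet_join_self (p q : Fm) : BoundedGiraleIdentity (p ⋏ (p ⋎ q), p)
  | join_meet_self (p q : Fm) : BoundedGiraleIdentity (p ⋎ (p ⋏ q), p)
  | mul_comm (p q : Fm) : BoundedGiraleIdentity (p ⊙ q, q ⊙ p)
  | mul_assoc (p q r : Fm) : BoundedGiraleIdentity (p ⊙ q ⊙ r, p ⊙ (q ⊙ r))
  | one_mul (p : Fm) : BoundedGiraleIdentity (Fm.one ⊙ p, p)
  | mul_join (p q r : Fm) : BoundedGiraleIdentity (p ⊙ (q ⋎ r), p ⊙ q ⋎ p ⊙ r)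
  | mul_imp_le (p q : Fm) : BoundedGiraleIdentity (p ⊙ (p ⊸ q) ⋏ q, p ⊙ (p ⊸ q))
  | le_imp_mul_join (p q r : Fm) : BoundedGiraleIdentity (q ⋏ (p ⊸ p ⊙ q ⋎ r), q)
  | zero_involutive (p : Fm) : BoundedGiraleIdentity ((p ⊸ Fm.zero) ⊸ Fm.zero, p)
  | neg_eq (p : Fm) : BoundedGiraleIdentity (p.neg, p ⊸ Fm.zero)
  | one_le_imp_top (p : Fm) : BoundedGiraleIdentity (Fm.one ⋏ (p ⊸ Fm.top), Fm.one)
  | bot_eq : BoundedGiraleIdentity (Fm.bot, Fm.top.neg)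
  | bang_one : BoundedGiraleIdentity (Fm.one.bang, Fm.one)
  | bang_le (p : Fm) : BoundedGiraleIdentity (p.bang ⋏ (p ⋏ Fm.one), p.bang)
  | bang_mul_bang (p q : Fm) : BoundedGiraleIdentity (p.bang ⊙ q.bang, (p ⋏ q).bang)
  | bang_bang (p : Fm) : BoundedGiraleIdentity (p.bang.bang, p.bang)

namespace BoundedGiraleIdentity

variable {A : LLAlgebra.{u}}

theorem holdsAt {e : Equation} (he : BoundedGiraleIdentity e) (hA : A.IsBoundedGirale)
    (v : ℕ → A.carrier) : e.HoldsAt A v := by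
  let := hA.toCommResiduatedLattice
  cases he with
  | meet_comm => exact hA.meet_comm _ _
  | meet_assoc => exact hA.meet_assoc _ _ _
  | join_comm => exact hA.join_comm _ _
  | join_assoc => exact hA.join_assoc _ _ _
  | meet_join_self => exact hA.meet_join_self _ _
  | join_meet_self => exact hA.join_meet_self _ _
  | mul_comm => exact hA.mul_comm _ _
  | mul_assoc => exact hA.mul_assoc _ _ _
  | one_mul => exact hA.one_mul _
  | mul_join => exact CommResiduatedLattice.mul_sup _ _ _
  | mul_imp_le => exact CommResiduatedLattice.mul_himp_le (α := A.carrier) _ _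
  | le_imp_mul_join => exact (hA.residuation _ _ _).1 (le_sup_left (α := A.carrier))
  | zero_involutive => exact hA.zero_involutive _
  | neg_eq => exact hA.neg_eq _
  | one_le_imp_top => exact hA.one_le_imp_top _
  | bot_eq => exact hA.bot_eq
  | bang_one => exact hA.bang_one
  | bang_le => exact hA.bang_le _
  | bang_mul_bang => exact hA.bang_mul_bang _ _
  | bang_bang => exact hA.bang_bang _

/-- The assignment of `a`, `b`, `c` to the first three variables, which is all that the identities
need. -/
def assign (a b c : A.carrier) : ℕ → A.carrier
  | 0 => a
  | 1 => b
  | _ => c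

theorem isCommResiduatedLattice
    (h : ∀ e, BoundedGiraleIdentity e → ∀ v : ℕ → A.carrier, e.HoldsAt A v) :
    A.IsCommResiduatedLattice := by
  let x := Fm.var 0
  let y := Fm.var 1
  let z := Fm.var 2
  have meet_comm a b : A.meet a b = A.meet b a := h _ (.meet_comm x y) (assign a b b)
  have meet_assoc a b c : A.meet (A.meet a b) c = A.meet a (A.meet b c) :=
    h _ (.meet_assoc x y z) (assign a b c)
  have join_comm a b : A.join a b = A.join b a := h _ (.join_comm x y) (assign a b b)
  have join_assoc a b c : A.join (A.join a b) c = A.join a (A.join b c) :=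
    h _ (.join_assoc x y z) (assign a b c)
  have meet_join_self a b : A.meet a (A.join a b) = a := h _ (.meet_join_self x y) (assign a b b)
  have join_meet_self a b : A.join a (A.meet a b) = a := h _ (.join_meet_self x y) (assign a b b)
  let := A.toLattice meet_comm meet_assoc join_comm join_assoc meet_join_self join_meet_self
  have gc_mul_imp (a : A.carrier) : GaloisConnection (A.mul a) (A.imp a) :=
    galoisConnection_of_map_sup (fun b c => h _ (.mul_join x y z) (assign a b c))
      (fun b => h _ (.mul_imp_le x y) (assign a b b))
      (fun b c => h _ (.le_imp_mul_join x y z) (assign a b c))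
  exact {
    meet_comm, meet_assoc, join_comm, join_assoc, meet_join_self, join_meet_self
    mul_comm := fun a b => h _ (.mul_comm x y) (assign a b b)
    mul_assoc := fun a b c => h _ (.mul_assoc x y z) (assign a b c)
    one_mul := fun a => h _ (.one_mul x) (assign a a a)
    residuation := gc_mul_imp }

theorem isBoundedGirale
    (h : ∀ e, BoundedGiraleIdentity e → ∀ v : ℕ → A.carrier, e.HoldsAt A v) :
    A.IsBoundedGirale where
  toIsCommResiduatedLattice := isCommResiduatedLattice h
  zero_involutive a := h _ (.zero_involutive (.var 0)) fun _ => a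
  neg_eq a := h _ (.neg_eq (.var 0)) fun _ => a
  one_le_imp_top a := h _ (.one_le_imp_top (.var 0)) fun _ => a
  bot_eq := h _ .bot_eq fun _ => A.one
  bang_one := h _ .bang_one fun _ => A.one
  bang_le a := h _ (.bang_le (.var 0)) fun _ => a
  bang_mul_bang a b := h _ (.bang_mul_bang (.var 0) (.var 1)) (assign a b b)
  bang_bang a := h _ (.bang_bang (.var 0)) fun _ => a

end BoundedGiraleIdentity

theorem isVariety_boundedGirales : IsVariety boundedGirales.{u} :=
  ⟨{e | BoundedGiraleIdentity e}, fun _ =>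
    ⟨fun hA _ he => he.holdsAt hA, BoundedGiraleIdentity.isBoundedGirale⟩⟩

/-! ### Derivations in linear logic -/

namespace LLDerivable

variable {Γ : Set Fm} {p q r p' q' : Fm}

theorem imp_refl (p : Fm) : LLDerivable Γ (p ⊸ p) := .ax (.hl1 p)

theorem imp_trans (h₁ : LLDerivable Γ (p ⊸ q)) (h₂ : LLDerivable Γ (q ⊸ r)) :
    LLDerivable Γ (p ⊸ r) :=
  .mp h₂ (.mp h₁ (.ax (.hl2 p q r)))

theorem imp_swap (h : LLDerivable Γ (p ⊸ q ⊸ r)) : LLDerivable Γ (q ⊸ p ⊸ r) :=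
  .mp h (.ax (.hl3 p q r))

theorem imp_mono (h₁ : LLDerivable Γ (p' ⊸ p)) (h₂ : LLDerivable Γ (q ⊸ q')) :
    LLDerivable Γ ((p ⊸ q) ⊸ (p' ⊸ q')) :=
  imp_trans (.mp h₁ (.ax (.hl2 p' p q))) (.mp h₂ (imp_swap (.ax (.hl2 p' q q'))))

theorem imp_mul (p q : Fm) : LLDerivable Γ (p ⊸ q ⊸ p ⊙ q) := .ax (.hl6 p q)

theorem mul_imp_imp_imp (p q r : Fm) : LLDerivable Γ ((p ⊙ q ⊸ r) ⊸ p ⊸ q ⊸ r) :=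
  imp_swap (imp_trans (imp_mul p q) (.ax (.hl2 q (p ⊙ q) r)))

theorem mul_imp_iff : LLDerivable Γ (p ⊙ q ⊸ r) ↔ LLDerivable Γ (p ⊸ q ⊸ r) :=
  ⟨fun h => .mp h (mul_imp_imp_imp p q r), fun h => .mp h (.ax (.hl7 p q r))⟩

theorem mul_comm (p q : Fm) : LLDerivable Γ (p ⊙ q ⊸ q ⊙ p) :=
  mul_imp_iff.2 (imp_swap (imp_mul q p))

theorem mul_mono (h₁ : LLDerivable Γ (p ⊸ p')) (h₂ : LLDerivable Γ (q ⊸ q')) :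
    LLDerivable Γ (p ⊙ q ⊸ p' ⊙ q') :=
  mul_imp_iff.2 (imp_trans h₁ (imp_trans (imp_mul p' q') (imp_mono h₂ (imp_refl _))))

theorem mul_assoc (p q r : Fm) : LLDerivable Γ (p ⊙ q ⊙ r ⊸ p ⊙ (q ⊙ r)) :=
  mul_imp_iff.2 (mul_imp_iff.2 (imp_trans (imp_mul p (q ⊙ r)) (mul_imp_imp_imp q r _)))

theorem mul_assoc_symm (p q r : Fm) : LLDerivable Γ (p ⊙ (q ⊙ r) ⊸ p ⊙ q ⊙ r) :=
  mul_imp_iff.2 (imp_trans (mul_imp_iff.1 (imp_mul (p ⊙ q) r)) (.ax (.hl7 _ _ _)))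

theorem meet_left (p q : Fm) : LLDerivable Γ (p ⋏ q ⊸ p) := .ax (.hl12 p q)

theorem meet_right (p q : Fm) : LLDerivable Γ (p ⋏ q ⊸ q) := .ax (.hl13 p q)

theorem imp_meet (h₁ : LLDerivable Γ (p ⊸ q)) (h₂ : LLDerivable Γ (p ⊸ r)) :
    LLDerivable Γ (p ⊸ q ⋏ r) :=
  .mp (.adj h₁ h₂) (.ax (.hl14 p q r))

theorem join_left (p q : Fm) : LLDerivable Γ (p ⊸ p ⋎ q) := .ax (.hl15 p q)

theorem join_right (p q : Fm) : LLDerivable Γ (q ⊸ p ⋎ q) := .ax (.hl16 p q)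

theorem join_imp (h₁ : LLDerivable Γ (p ⊸ r)) (h₂ : LLDerivable Γ (q ⊸ r)) :
    LLDerivable Γ (p ⋎ q ⊸ r) :=
  .mp (.adj h₁ h₂) (.ax (.hl17 p q r))

theorem meet_mono (h₁ : LLDerivable Γ (p ⊸ p')) (h₂ : LLDerivable Γ (q ⊸ q')) :
    LLDerivable Γ (p ⋏ q ⊸ p' ⋏ q') :=
  imp_meet (imp_trans (meet_left p q) h₁) (imp_trans (meet_right p q) h₂)

theorem join_mono (h₁ : LLDerivable Γ (p ⊸ p')) (h₂ : LLDerivable Γ (q ⊸ q')) :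
    LLDerivable Γ (p ⋎ q ⊸ p' ⋎ q') :=
  join_imp (imp_trans h₁ (join_left p' q')) (imp_trans h₂ (join_right p' q'))

theorem one_imp_iff : LLDerivable Γ (Fm.one ⊸ p) ↔ LLDerivable Γ p :=
  ⟨fun h => .mp (.ax .hl8) h, fun h => .mp h (imp_swap (.ax (.hl9 p)))⟩

theorem imp_neg_neg (p : Fm) : LLDerivable Γ (p ⊸ p.neg.neg) :=
  .mp (imp_refl p.neg) (.ax (.hl5 p.neg p))

theorem neg_mono (h : LLDerivable Γ (p ⊸ q)) : LLDerivable Γ (q.neg ⊸ p.neg) :=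
  .mp (imp_trans h (imp_neg_neg q)) (.ax (.hl5 p q.neg))

theorem neg_imp_imp_zero (p : Fm) : LLDerivable Γ (p.neg ⊸ (p ⊸ Fm.zero)) :=
  imp_swap (.ax (.hl10 p))

theorem imp_zero_imp_neg (p : Fm) : LLDerivable Γ ((p ⊸ Fm.zero) ⊸ p.neg) :=
  imp_trans (imp_mono (imp_refl p) (imp_neg_neg Fm.zero))
    (.mp (.ax .hl11) (imp_swap (.ax (.hl5 p Fm.zero.neg))))

theorem bang_mono (h : LLDerivable Γ (p ⊸ q)) : LLDerivable Γ (p.bang ⊸ q.bang) :=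
  .mp (.nec h) (.ax (.hl22 p q))

theorem bang_imp_one (p : Fm) : LLDerivable Γ (p.bang ⊸ Fm.one) :=
  .mp (.ax .hl8) (.ax (.hl20 p Fm.one))

theorem bang_imp_self (p : Fm) : LLDerivable Γ (p.bang ⊸ p) := .ax (.hl23 p)

theorem bang_imp_bang_bang (p : Fm) : LLDerivable Γ (p.bang ⊸ p.bang.bang) := .ax (.hl24 p)

theorem bang_imp_bang_imp_meet (p q : Fm) : LLDerivable Γ (p.bang ⊸ q.bang ⊸ p ⋏ q) :=
  have left : LLDerivable Γ (p.bang ⊸ q.bang ⊸ p) :=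
    imp_trans (bang_imp_self p) (.ax (.hl20 q p))
  have right : LLDerivable Γ (p.bang ⊸ q.bang ⊸ q) :=
    .mp (bang_imp_self q) (.ax (.hl20 p (q.bang ⊸ q)))
  mul_imp_iff.1 (imp_meet (mul_imp_iff.2 left) (mul_imp_iff.2 right))

theorem bang_mul_bang_imp (p q : Fm) : LLDerivable Γ (p.bang ⊙ q.bang ⊸ (p ⋏ q).bang) := by
  have promoted : LLDerivable Γ (p.bang ⊸ (q.bang ⊸ p ⋏ q).bang) :=
    imp_trans (bang_imp_bang_bang p) (bang_mono (bang_imp_bang_imp_meet p q))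
  have distributed : LLDerivable Γ (p.bang ⊸ q.bang.bang ⊸ (p ⋏ q).bang) :=
    imp_trans promoted (.ax (.hl22 q.bang (p ⋏ q)))
  exact mul_imp_iff.2 (imp_trans distributed (imp_mono (bang_imp_bang_bang q) (imp_refl _)))

theorem bang_meet_imp (p q : Fm) : LLDerivable Γ ((p ⋏ q).bang ⊸ p.bang ⊙ q.bang) := by
  have left : LLDerivable Γ ((p ⋏ q).bang ⊸ p.bang) := bang_mono (meet_left p q)
  have right : LLDerivable Γ ((p ⋏ q).bang ⊸ q.bang) := bang_mono (meet_right p q)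
  have twice : LLDerivable Γ ((p ⋏ q).bang ⊸ (p ⋏ q).bang ⊸ p.bang ⊙ q.bang) :=
    imp_trans left (imp_trans (imp_mul p.bang q.bang) (imp_mono right (imp_refl _)))
  exact .mp twice (.ax (.hl21 (p ⋏ q) (p.bang ⊙ q.bang)))

end LLDerivable

/-! ### The Lindenbaum–Tarski algebra of a set of premises -/

/-- Provable equivalence of formulas from the premises `Γ`. -/
def lindenbaumSetoid (Γ : Set Fm) : Setoid Fm where
  r p q := LLDerivable Γ (p ⊸ q) ∧ LLDerivable Γ (q ⊸ p)
  iseqv :=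
    { refl := fun p => ⟨.imp_refl p, .imp_refl p⟩
      symm := fun h => ⟨h.2, h.1⟩
      trans := fun h₁ h₂ => ⟨.imp_trans h₁.1 h₂.1, .imp_trans h₂.2 h₁.2⟩ }

/-- The Lindenbaum–Tarski algebra of linear logic over the premises `Γ`: formulas modulo provable
equivalence, lifted to the universe of the algebras under consideration. -/
def lindenbaum (Γ : Set Fm) : LLAlgebra.{u} where
  carrier := ULift.{u} (Quotient (lindenbaumSetoid Γ))
  meet a b := ⟨Quotient.map₂ Fm.meet (fun _ _ (h₁ : _ ∧ _) _ _ (h₂ : _ ∧ _) =>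
    ⟨.meet_mono h₁.1 h₂.1, .meet_mono h₁.2 h₂.2⟩) a.down b.down⟩
  join a b := ⟨Quotient.map₂ Fm.join (fun _ _ (h₁ : _ ∧ _) _ _ (h₂ : _ ∧ _) =>
    ⟨.join_mono h₁.1 h₂.1, .join_mono h₁.2 h₂.2⟩) a.down b.down⟩
  imp a b := ⟨Quotient.map₂ Fm.imp (fun _ _ (h₁ : _ ∧ _) _ _ (h₂ : _ ∧ _) =>
    ⟨.imp_mono h₁.2 h₂.1, .imp_mono h₁.1 h₂.2⟩) a.down b.down⟩
  mul a b := ⟨Quotient.map₂ Fm.mul (fun _ _ (h₁ : _ ∧ _) _ _ (h₂ : _ ∧ _) =>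
    ⟨.mul_mono h₁.1 h₂.1, .mul_mono h₁.2 h₂.2⟩) a.down b.down⟩
  neg a := ⟨Quotient.map Fm.neg (fun _ _ (h : _ ∧ _) => ⟨.neg_mono h.2, .neg_mono h.1⟩) a.down⟩
  bang a := ⟨Quotient.map Fm.bang (fun _ _ (h : _ ∧ _) => ⟨.bang_mono h.1, .bang_mono h.2⟩) a.down⟩
  one := ⟨Quotient.mk _ Fm.one⟩
  zero := ⟨Quotient.mk _ Fm.zero⟩
  top := ⟨Quotient.mk _ Fm.top⟩
  bot := ⟨Quotient.mk _ Fm.bot⟩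

namespace lindenbaum

variable {Γ : Set Fm} {p q : Fm}

/-- The class of a formula in the Lindenbaum–Tarski algebra. -/
def mk (Γ : Set Fm) (p : Fm) : (lindenbaum.{u} Γ).carrier :=
  ⟨Quotient.mk (lindenbaumSetoid Γ) p⟩

theorem mk_surjective (Γ : Set Fm) : Function.Surjective (mk.{u} Γ) := by
  rintro ⟨⟨p⟩⟩
  exact ⟨p, rfl⟩

theorem mk_eq_iff :
    mk.{u} Γ p = mk.{u} Γ q ↔ LLDerivable Γ (p ⊸ q) ∧ LLDerivable Γ (q ⊸ p) :=
  ULift.up_injective.eq_iff.trans Quotient.eq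

theorem mk_eq (h₁ : LLDerivable Γ (p ⊸ q)) (h₂ : LLDerivable Γ (q ⊸ p)) :
    mk.{u} Γ p = mk.{u} Γ q :=
  mk_eq_iff.2 ⟨h₁, h₂⟩

theorem le_mk_iff : (lindenbaum.{u} Γ).le (mk Γ p) (mk Γ q) ↔ LLDerivable Γ (p ⊸ q) :=
  mk_eq_iff.trans ⟨fun h => .imp_trans h.2 (.meet_right p q),
    fun h => ⟨.meet_left p q, .imp_meet (.imp_refl p) h⟩⟩

theorem eval_mk (Γ : Set Fm) (p : Fm) :
    (lindenbaum.{u} Γ).eval (fun n => mk Γ (.var n)) p = mk Γ p := by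
  induction p with
  | var n => rfl
  | meet p q ih₁ ih₂ => rw [LLAlgebra.eval, ih₁, ih₂]; rfl
  | join p q ih₁ ih₂ => rw [LLAlgebra.eval, ih₁, ih₂]; rfl
  | imp p q ih₁ ih₂ => rw [LLAlgebra.eval, ih₁, ih₂]; rfl
  | mul p q ih₁ ih₂ => rw [LLAlgebra.eval, ih₁, ih₂]; rfl
  | neg p ih => rw [LLAlgebra.eval, ih]; rfl
  | bang p ih => rw [LLAlgebra.eval, ih]; rfl
  | one => rfl
  | zero => rfl
  | top => rfl
  | bot => rfl

open LLDerivable in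
theorem isCommResiduatedLattice (Γ : Set Fm) : (lindenbaum.{u} Γ).IsCommResiduatedLattice where
  meet_comm := (mk_surjective Γ).forall₂.2 fun p q => mk_eq
    (imp_meet (meet_right p q) (meet_left p q)) (imp_meet (meet_right q p) (meet_left q p))
  meet_assoc := (mk_surjective Γ).forall₃.2 fun p q r => mk_eq
    (imp_meet (imp_trans (meet_left _ r) (meet_left p q))
      (meet_mono (meet_right p q) (imp_refl r)))
    (imp_meet (meet_mono (imp_refl p) (meet_left q r))
      (imp_trans (meet_right p _) (meet_right q r)))
  join_comm := (mk_surjective Γ).forall₂.2 fun p q => mk_eq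
    (join_imp (join_right q p) (join_left q p)) (join_imp (join_right p q) (join_left p q))
  join_assoc := (mk_surjective Γ).forall₃.2 fun p q r => mk_eq
    (join_imp (join_mono (imp_refl p) (join_left q r))
      (imp_trans (join_right q r) (join_right p _)))
    (join_imp (imp_trans (join_left p q) (join_left _ r))
      (join_mono (join_right p q) (imp_refl r)))
  meet_join_self := (mk_surjective Γ).forall₂.2 fun p q => mk_eq
    (meet_left p _) (imp_meet (imp_refl p) (join_left p q))
  join_meet_self := (mk_surjective Γ).forall₂.2 fun p q => mk_eq
    (join_imp (imp_refl p) (meet_left p q)) (join_left p _)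
  mul_comm := (mk_surjective Γ).forall₂.2 fun p q =>
    mk_eq (LLDerivable.mul_comm p q) (LLDerivable.mul_comm q p)
  mul_assoc := (mk_surjective Γ).forall₃.2 fun p q r =>
    mk_eq (LLDerivable.mul_assoc p q r) (LLDerivable.mul_assoc_symm p q r)
  one_mul := (mk_surjective Γ).forall.2 fun p =>
    mk_eq (mul_imp_iff.2 (.ax (.hl9 p))) (one_imp_iff.1 (imp_mul Fm.one p))
  residuation := (mk_surjective Γ).forall₃.2 fun p q r => by
    have : LLDerivable Γ (p ⊙ q ⊸ r) ↔ LLDerivable Γ (q ⊸ p ⊸ r) :=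
      mul_imp_iff.trans ⟨imp_swap, imp_swap⟩
    exact le_mk_iff.trans (this.trans le_mk_iff.symm)

open LLDerivable in
theorem isBoundedGirale (Γ : Set Fm) : (lindenbaum.{u} Γ).IsBoundedGirale where
  toIsCommResiduatedLattice := isCommResiduatedLattice Γ
  zero_involutive := (mk_surjective Γ).forall.2 fun p => mk_eq
    (imp_trans (imp_trans (imp_zero_imp_neg _) (neg_mono (neg_imp_imp_zero p))) (.ax (.hl4 p)))
    (imp_swap (imp_refl _))
  neg_eq := (mk_surjective Γ).forall.2 fun p => mk_eq (neg_imp_imp_zero p) (imp_zero_imp_neg p)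
  one_le_imp_top := (mk_surjective Γ).forall.2 fun p =>
    le_mk_iff.2 (one_imp_iff.2 (.ax (.hl18 p)))
  bot_eq := mk_eq (.ax (.hl19 _))
    (imp_trans (neg_mono (.ax (.hl18 Fm.bot.neg))) (.ax (.hl4 Fm.bot)))
  bang_one := mk_eq (bang_imp_one Fm.one) (one_imp_iff.2 (.nec (.ax .hl8)))
  bang_le := (mk_surjective Γ).forall.2 fun p =>
    le_mk_iff.2 (imp_meet (bang_imp_self p) (bang_imp_one p))
  bang_mul_bang := (mk_surjective Γ).forall₂.2 fun p q =>
    mk_eq (bang_mul_bang_imp p q) (bang_meet_imp p q)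
  bang_bang := (mk_surjective Γ).forall.2 fun p =>
    mk_eq (bang_imp_self p.bang) (bang_imp_bang_bang p)

theorem one_le_eval_iff :
    (lindenbaum.{u} Γ).le (lindenbaum Γ).one
      ((lindenbaum Γ).eval (fun n => mk Γ (.var n)) p) ↔ LLDerivable Γ p := by
  rw [eval_mk]
  exact le_mk_iff.trans LLDerivable.one_imp_iff

end lindenbaum

/-! ### Algebraizability of linear logic -/

theorem llDerivable_iff {Γ : Set Fm} {p : Fm} :
    LLDerivable Γ p ↔ ∀ A ∈ boundedGirales.{u}, ∀ v : ℕ → A.carrier,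
      (∀ q ∈ Γ, A.le A.one (A.eval v q)) → A.le A.one (A.eval v p) := by
  constructor
  · exact fun hp A hA v hΓ => hA.one_le_eval_of_llDerivable v hΓ hp
  · intro h
    exact lindenbaum.one_le_eval_iff.1 <| h _ (lindenbaum.isBoundedGirale Γ) _ fun q hq =>
      lindenbaum.one_le_eval_iff.2 (.hyp hq)

/-- The defining equation `1 ∧ x ≈ 1`, which says `1 ≤ x`. -/
def oneLeEquation : Equation := (Fm.one ⋏ Fm.var 0, Fm.one)

open Classical in
/-- The equivalence formulas `x → y` and `y → x` of linear logic. -/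
noncomputable def biimplication : Finset Fm :=
  {Fm.var 0 ⊸ Fm.var 1, Fm.var 1 ⊸ Fm.var 0}

theorem mem_designated_oneLeEquation {A : LLAlgebra.{u}} {a : A.carrier} :
    a ∈ A.designated {oneLeEquation} ↔ A.le A.one a := by
  simp only [LLAlgebra.designated, Finset.mem_singleton, forall_eq, Set.mem_ofPred_eq]
  exact Iff.rfl

theorem fmInst_biimplication (p q : Fm) : fmInst biimplication p q = {p ⊸ q, q ⊸ p} := by
  ext r
  simp [fmInst, biimplication, Fm.inst₂, Fm.subst]

theorem isAlgebraization_boundedGirales :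
    IsAlgebraization LL boundedGirales.{u} {oneLeEquation} biimplication where
  cons_iff Γ p := by
    simp only [mem_designated_oneLeEquation]
    exact llDerivable_iff
  eval_eq_iff A hA v p q := by
    have hA : A.IsBoundedGirale := hA
    let := hA.toCommResiduatedLattice
    simp only [fmInst_biimplication, Set.mem_insert_iff, Set.mem_singleton_iff, forall_eq_or_imp,
      forall_eq, mem_designated_oneLeEquation, LLAlgebra.eval, hA.one_le_imp_iff]
    exact le_antisymm_iff

theorem isEquivalentAlgebraicSemantics_boundedGirales :
    IsEquivalentAlgebraicSemantics LL boundedGirales.{u} :=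
  isEquivalentAlgebraicSemantics_iff.2 ⟨{oneLeEquation}, biimplication,
    by simp [oneLeEquation, Fm.vars], by simp [biimplication, Fm.vars, Set.insert_subset_iff],
    isAlgebraization_boundedGirales⟩

theorem isTheEquivalentAlgebraicSemantics_boundedGirales :
    IsTheEquivalentAlgebraicSemantics LL boundedGirales.{u} :=
  have hG := isVariety_boundedGirales.isQuasivariety
  have hLL := isEquivalentAlgebraicSemantics_boundedGirales
  ⟨⟨hG, hLL⟩, fun _ hK hK' => hK'.unique hLL hK hG⟩

end LinearLogic

theorem mainTheorem1 :
    LinearLogic.IsStronglyAlgebraizable.{u} LinearLogic.LL ∧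
    LinearLogic.IsVariety LinearLogic.boundedGirales.{u} ∧
    LinearLogic.IsTheEquivalentAlgebraicSemantics LinearLogic.LL
      LinearLogic.boundedGirales.{u} :=
  have isVariety := LinearLogic.isVariety_boundedGirales
  have isSemantics := LinearLogic.isTheEquivalentAlgebraicSemantics_boundedGirales
  ⟨⟨_, isSemantics, isVariety⟩, isVariety, isSemantics⟩
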